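/- Let $P\in\mathbb R[x]$ be a non-constant even polynomial, of degree $d$, with $|P(x)|\le 1$ for all $x\in[-1,1]$. Then there is a polynomial $\tilde P\in\mathbb R[x]$ of degree $d/2$ with $P(x)=\tilde P(x^2)$ for all $x\in\mathbb R$, and there is $\Phi=(\phi_1,\dots,\phi_d)\in\mathbb R^d$, depending only on $P$, such that the following holds for every finite-dimensional complex Hilbert space $\mathcal H$, every unitary operator $O$ on $\mathcal H$ and all orthogonal projectors $\Pi,\tilde\Pi$ on $\mathcal H$. Let $B$ be an auxiliary qubit with Hadamard gate $H_B$, NOT gate $X_B$ and rotations $R_z(\alpha)=\mathrm{diag}(e^{-i\alpha/2},e^{i\alpha/2})$. On $\mathcal H\otimes\mathbb C^2_B$ put $C_\Pi X=\Pi\otimes X_B+(I-\Pi)\otimes I_B$ and $$R_j=(C_\Pi X)\,\bigl(I\otimes R_z(-2\phi_j)\bigr)\,(C_\Pi X),\qquad \tilde R_j=(C_{\tilde\Pi} X)\,\bigl(I\otimes R_z(-2\phi_j)\bigr)\,(C_{\tilde\Pi} X),$$ let $Q_j=\tilde R_j\,(O\otimes I_B)$ for odd $j$ and $Q_j=R_j\,(O^\dagger\otimes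 I_B)$ for even $j$, and let $Q=H_B\,Q_d\,Q_{d-1}\cdots Q_1\,H_B$. Then $$\langle 0|_B\,\Pi\,Q\,\Pi\,|0\rangle_B=\tilde P\bigl(\Pi O^\dagger\tilde\Pi\tilde\Pi O\Pi\bigr)$$ as operators on the image of $\Pi$ (that is, the constant term $a_0$ of $\tilde P$ contributes $a_0\Pi$, and both sides vanish on the orthogonal complement of that image). Moreover, put $r=\dim\operatorname{im}\Pi$, $\tilde r=\dim\operatorname{im}\tilde\Pi$ and $m=\min\{r,\tilde r\}$. There are an orthonormal basis $(\psi_i)_{i\le r}$ of $\operatorname{im}\Pi$, an orthonormal basis $(\tilde\psi_i)_{i\le\tilde r}$ of $\operatorname{im}\tilde\Pi$ and reals $0\le\zeta_1\le\dots\le\zeta_m$ with $\tilde\Pi O\Pi=\sum_{i=1}^m\zeta_i|\tilde\psi_i\rangle\langle\psi_i|$, and for every such singular value decomposition, with $\zeta_i:=0$ for $m<i\le r$, $$\langle 0|_B\,\Pi\,Q\,\Pi\,|0\rangle_B=P^{(SV)}(\tilde\Pi O\Pi):=\sum_{i=1}^{r}P(\zeta_i)\,|\psi_i\rangle\langle\psi_i|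 .$$ -/

import Mathlib

open scoped TensorProduct

noncomputable section

namespace QSVT

/-- The one-qubit register `B`. -/
abbrev Qubit : Type := EuclideanSpace ℂ (Fin 2)

/-- The computational basis vector `|b⟩`. -/
def ketVec (b : Fin 2) : Qubit := EuclideanSpace.single b 1

/-- The Hadamard gate. -/
def hadamard : Qubit →ₗ[ℂ] Qubit :=
  Matrix.toEuclideanLin (((Real.sqrt 2 : ℝ) : ℂ)⁻¹ • !![1, 1; 1, -1])

/-- The NOT gate. -/
def pauliX : Qubit →ₗ[ℂ] Qubit :=
  Matrix.toEuclideanLin !![0, 1; 1, 0]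

/-- The rotation about `z` of angle `α`, `diag(e^{-iα/2}, e^{iα/2})`. -/
def rotZ (α : ℝ) : Qubit →ₗ[ℂ] Qubit :=
  Matrix.toEuclideanLin
    !![Complex.exp (-(Complex.I * (α / 2 : ℂ))), 0; 0, Complex.exp (Complex.I * (α / 2 : ℂ))]

section Circuit

variable {H : Type*} [NormedAddCommGroup H] [InnerProductSpace ℂ H]

/-- An operator on the main system, acting trivially on `B`. -/
def onSystem (T : H →ₗ[ℂ] H) : Module.End ℂ (H ⊗[ℂ] Qubit) :=
  TensorProduct.map T LinearMap.id

/-- An operator on the register `B`, acting trivially on the main system. -/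
def onB (G : Qubit →ₗ[ℂ] Qubit) : Module.End ℂ (H ⊗[ℂ] Qubit) :=
  TensorProduct.map LinearMap.id G

/-- The ket `|b⟩_B`, as an operator `v ↦ v ⊗ |b⟩`. -/
def ketB (b : Fin 2) : H →ₗ[ℂ] H ⊗[ℂ] Qubit :=
  (TensorProduct.mk ℂ H Qubit).flip (ketVec b)

/-- The bra `⟨b|_B`, as an operator `v ⊗ w ↦ ⟨b|w⟩ v`. -/
def braB (b : Fin 2) : H ⊗[ℂ] Qubit →ₗ[ℂ] H :=
  (TensorProduct.rid ℂ H).toLinearMap ∘ₗ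
    LinearMap.lTensor H (innerSL ℂ (ketVec b)).toLinearMap

/-- The NOT gate on `B` controlled by the projector `E`: `E ⊗ X + (1 - E) ⊗ 1`. -/
def controlledX (E : H →ₗ[ℂ] H) : Module.End ℂ (H ⊗[ℂ] Qubit) :=
  onSystem E * onB pauliX + onSystem (1 - E)

/-- The phase reflection about the range of the projector `E`, with phase `φ`. -/
def phaseReflection (E : H →ₗ[ℂ] H) (φ : ℝ) : Module.End ℂ (H ⊗[ℂ] Qubit) :=
  controlledX E * onB (rotZ (-2 * φ)) * controlledX E

variable [FiniteDimensional ℂ H]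

/-- The `j`-th step of the circuit (`j = 1, 2, …`): for odd `j` apply `O` and then the reflection
about the range of `E'`; for even `j` apply `O†` and then the reflection about the range of `E`. -/
def step (O E E' : H →ₗ[ℂ] H) (j : ℕ) (φ : ℝ) : Module.End ℂ (H ⊗[ℂ] Qubit) :=
  if Odd j then phaseReflection E' φ * onSystem O
  else phaseReflection E φ * onSystem (LinearMap.adjoint O)

/-- The circuit `H_B Q_d ⋯ Q_1 H_B`; the phase of `Q_{j+1}` is `Φ j`, `j = 0, …, d - 1`. -/
def circuit (O E E' : H →ₗ[ℂ] H) {d : ℕ} (Φ : Fin d → ℝ) : Module.End ℂ (H ⊗[ℂ] Qubit) :=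
  onB hadamard *
    (List.ofFn fun j : Fin d => step O E E' ((j : ℕ) + 1) (Φ j)).reverse.prod *
    onB hadamard

/-- The block `⟨0|_B E Q E |0⟩_B` of the circuit `Q`. -/
def circuitBlock (O E E' : H →ₗ[ℂ] H) {d : ℕ} (Φ : Fin d → ℝ) : Module.End ℂ H :=
  braB 0 ∘ₗ (onSystem E * circuit O E E' Φ * onSystem E) ∘ₗ ketB 0

end Circuit

section SVD

variable {H : Type*} [NormedAddCommGroup H] [InnerProductSpace ℂ H]

/-- The operator `|x⟩⟨y|`. -/
def ketbra (x y : H) : Module.End ℂ H :=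
  (innerSL ℂ y).toLinearMap.smulRight x

open Module in
/-- A singular value decomposition of `E' O E`, where `E` and `E'` are orthogonal projectors:
orthonormal bases `ψ` of the range of `E` and `ψ'` of the range of `E'`, and an increasing sequence
of singular values `ζ`, indexed up to the smaller of the two dimensions. -/
structure SingularValueDecomposition [FiniteDimensional ℂ H] (O E E' : Module.End ℂ H) where
  ψ : OrthonormalBasis (Fin (finrank ℂ (LinearMap.range E))) ℂ (LinearMap.range E)
  ψ' : OrthonormalBasis (Fin (finrank ℂ (LinearMap.range E'))) ℂ (LinearMap.range E')
  ζ : Fin (min (finrank ℂ (LinearMap.range E)) (finrank ℂ (LinearMap.range E'))) → ℝ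
  ζ_nonneg : ∀ i, 0 ≤ ζ i
  ζ_mono : Monotone ζ
  decomp : E' * O * E =
    ∑ i, (ζ i : ℂ) • ketbra (ψ' (i.castLE (min_le_right _ _)) : H)
      (ψ (i.castLE (min_le_left _ _)) : H)

variable [FiniteDimensional ℂ H] {O E E' : Module.End ℂ H}

open Module in
/-- The singular value belonging to the right singular vector `ψ i`; it is `0` for the vectors
in excess of the smaller dimension. -/
def SingularValueDecomposition.rightValue (S : SingularValueDecomposition O E E')
    (i : Fin (finrank ℂ (LinearMap.range E))) : ℝ :=
  if h : (i : ℕ) < min (finrank ℂ (LinearMap.range E)) (finrank ℂ (LinearMap.range E')) then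
    S.ζ ⟨i, h⟩
  else 0

/-- The even singular value transform `∑ i, P(ζ i) |ψ i⟩⟨ψ i|`, the sum running over the whole
basis `ψ` of the range of `E`. -/
def SingularValueDecomposition.evenTransform (S : SingularValueDecomposition O E E')
    (P : Polynomial ℝ) : Module.End ℂ H :=
  ∑ i, ((P.eval (S.rightValue i) : ℝ) : ℂ) • ketbra (S.ψ i : H) (S.ψ i : H)

end SVD

end QSVT

end

/-! Write P(x) = Q(x²) with deg Q = d/2. Then |Q| ≤ 1 on [0,1], so 1 - Q² is nonnegative there and
has even degree d. The Markov–Lukács theorem (`hasLukacsForm_of_nonneg`) gives 1 - Q² = B² +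
X(1-X)D². Hence p = Q + iB and q = D satisfy p p* + X(1-X) q q* = 1, where * conjugates
coefficients.

Such a pair arises from d elementary phase steps: the top coefficient of the identity lets one
choose a phase that lowers the degree (`IsUnitaryPair.exists_pred`). Since p* belongs to the negated
phases, Q is the average of the polynomials of Φ and -Φ. The circuit forms this average: every step
is diagonal on B, with opposite phases on |0⟩ and |1⟩, and the Hadamards average the two branches
(`circuitBlock_eq`).

On the operator side put S = O†E'O and M = ESE. If v lies in the range of E and Mv = xv, then v and
(1-E)Sv are orthogonal with squared norms in ratio 1 : x(1-x), and Sv and (1-S)v with ratio x : 1-x;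
these are the weights in the unitarity identities. `phaseProd_mul` tracks the coefficients in these
two frames as polynomials in M, without diagonalizing. Finally the right singular vectors are
eigenvectors of M with eigenvalues ζ², so Q(M) acts on them by P(ζ). -/

namespace QSVT

open Polynomial

/-! ### Markov–Lukács certificates on the unit interval -/

section IntervalPositivity

/-- Bounds are strict and on `degree`, so that the bound `0` forces the zero polynomial, as the
second component of a certificate of degree 0 requires. -/
theorem degree_mul_lt {R : Type*} [Semiring R] {l p : R[X]} {m n k : ℕ} (hl : l.natDegree ≤ m)
    (hp : p.degree < (n : ℕ)) (h : m + n ≤ k) : (l * p).degree < (k : ℕ) := by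
  rw [degree_lt_iff_coeff_zero] at hp ⊢
  intro i hi
  rw [coeff_mul]
  refine Finset.sum_eq_zero fun x hx => ?_
  replace hx := Finset.HasAntidiagonal.mem_antidiagonal.1 hx
  by_cases h1 : x.1 ≤ m
  · rw [hp x.2 (by omega), mul_zero]
  · rw [coeff_eq_zero_of_natDegree_lt (by omega), zero_mul]

theorem degree_add_lt {R : Type*} [Semiring R] {p q : R[X]} {n : WithBot ℕ} (hp : p.degree < n)
    (hq : q.degree < n) : (p + q).degree < n :=
  (degree_add_le _ _).trans_lt (max_lt hp hq)

theorem degree_sub_lt_of_lt {R : Type*} [Ring R] {p q : R[X]} {n : WithBot ℕ} (hp : p.degree < n)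
    (hq : q.degree < n) : (p - q).degree < n :=
  (degree_sub_le _ _).trans_lt (max_lt hp hq)

/-- The Markov–Lukács certificate of nonnegativity on `[0, 1]` for a polynomial of degree at
most `n`. -/
def HasLukacsForm (n : ℕ) (F : ℝ[X]) : Prop :=
  (∀ k, n = 2 * k → ∃ B C : ℝ[X], B.degree < (k + 1 : ℕ) ∧ C.degree < (k : ℕ) ∧
    F = B ^ 2 + X * (1 - X) * C ^ 2) ∧
  (∀ k, n = 2 * k + 1 → ∃ B C : ℝ[X], B.degree < (k + 1 : ℕ) ∧ C.degree < (k + 1 : ℕ) ∧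
    F = X * B ^ 2 + (1 - X) * C ^ 2)

theorem natDegree_one_sub_X_le {R : Type*} [Ring R] : (1 - X : R[X]).natDegree ≤ 1 := by
  compute_degree

theorem natDegree_X_mul_one_sub_X_le {R : Type*} [Ring R] :
    (X * (1 - X) : R[X]).natDegree ≤ 2 := by
  compute_degree

theorem hasLukacsForm_C {c : ℝ} (hc : 0 ≤ c) : HasLukacsForm 0 (C c) := by
  refine ⟨fun k hk => ⟨C (√c), 0, ?_, ?_, ?_⟩, fun k hk => by omega⟩
  · exact degree_C_le.trans_lt (by exact_mod_cast Nat.succ_pos k)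
  · rw [degree_zero]; exact WithBot.bot_lt_coe k
  · rw [← C_pow, Real.sq_sqrt hc]; simp

/-- On [0,1] certificates are squared moduli, of B + i√(X(1-X))C or of √X B + i√(1-X)C, and the new
factor is that of a√X + ib√(1-X). Multiplying the complex numbers, up to conjugation, gives the new
certificate, of the other parity. -/
theorem HasLukacsForm.mul_linear {n : ℕ} {F : ℝ[X]} (h : HasLukacsForm n F) {α β : ℝ}
    (hα : 0 ≤ α) (hβ : 0 ≤ β) : HasLukacsForm (n + 1) ((C α * X + C β * (1 - X)) * F) := by
  have hα' : C α = C (√α) ^ 2 := by rw [← C_pow, Real.sq_sqrt hα]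
  have hβ' : C β = C (√β) ^ 2 := by rw [← C_pow, Real.sq_sqrt hβ]
  have c0 (a : ℝ) : (C a).natDegree ≤ 0 := (natDegree_C a).le
  rw [hα', hβ']
  generalize √α = a
  generalize √β = b
  constructor
  · intro k hk
    obtain ⟨k, rfl⟩ : ∃ j, k = j + 1 := ⟨k - 1, by omega⟩
    obtain ⟨B, D, hB, hD, rfl⟩ := h.2 k (by omega)
    refine ⟨C a * X * B - C b * (1 - X) * D, C b * B + C a * D, ?_, ?_, by ring⟩
    · exact degree_sub_lt_of_lt (degree_mul_lt (m := 1) (by compute_degree) hB (by omega))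
        (degree_mul_lt (m := 1) (by compute_degree) hD (by omega))
    · exact degree_add_lt (degree_mul_lt (c0 _) hB (by omega))
        (degree_mul_lt (c0 _) hD (by omega))
  · intro k hk
    obtain ⟨B, D, hB, hD, rfl⟩ := h.1 k (by omega)
    refine ⟨C a * B + C b * (1 - X) * D, C b * B - C a * X * D, ?_, ?_, by ring⟩
    · exact degree_add_lt (degree_mul_lt (c0 _) hB (by omega))
        (degree_mul_lt (m := 1) (by compute_degree) hD (by omega))
    · exact degree_sub_lt_of_lt (degree_mul_lt (c0 _) hB (by omega))
        (degree_mul_lt (m := 1) (by compute_degree) hD (by omega))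

/-- The same composition of squared moduli, with a factor of even type, so the parity is kept. -/
theorem HasLukacsForm.mul_quadratic {n : ℕ} {F D : ℝ[X]} (h : HasLukacsForm n F)
    (hD : D.natDegree ≤ 1) (c : ℝ) :
    HasLukacsForm (n + 2) ((D ^ 2 + X * (1 - X) * C c ^ 2) * F) := by
  have c0 (a : ℝ) : (C a).natDegree ≤ 0 := (natDegree_C a).le
  constructor
  · intro k hk
    obtain ⟨k, rfl⟩ : ∃ j, k = j + 1 := ⟨k - 1, by omega⟩
    obtain ⟨B, G, hB, hG, rfl⟩ := h.1 k (by omega)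
    refine ⟨D * B - C c * (X * (1 - X)) * G, C c * B + D * G, ?_, ?_, by ring⟩
    · exact degree_sub_lt_of_lt (degree_mul_lt hD hB (by omega))
        (degree_mul_lt (m := 2) (by compute_degree) hG (by omega))
    · exact degree_add_lt (degree_mul_lt (c0 _) hB (by omega)) (degree_mul_lt hD hG (by omega))
  · intro k hk
    obtain ⟨k, rfl⟩ : ∃ j, k = j + 1 := ⟨k - 1, by omega⟩
    obtain ⟨B, G, hB, hG, rfl⟩ := h.2 k (by omega)
    refine ⟨D * B + C c * (1 - X) * G, D * G - C c * X * B, ?_, ?_, by ring⟩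
    · exact degree_add_lt (degree_mul_lt hD hB (by omega))
        (degree_mul_lt (m := 1) (by compute_degree) hG (by omega))
    · exact degree_sub_lt_of_lt (degree_mul_lt hD hG (by omega))
        (degree_mul_lt (m := 1) (by compute_degree) hB (by omega))

/-- A positive definite real quadratic, in Markov–Lukács form. -/
theorem quadratic_eq_lukacs (u v : ℝ) : ∃ (D : ℝ[X]) (c : ℝ), D.natDegree ≤ 1 ∧
    X ^ 2 - C (2 * u) * X + C (u ^ 2 + v ^ 2) = D ^ 2 + X * (1 - X) * C c ^ 2 := by
  obtain ⟨α, hα0, hα⟩ : ∃ α : ℝ, 0 ≤ α ∧ α ^ 2 = (1 - u) ^ 2 + v ^ 2 :=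
    ⟨√((1 - u) ^ 2 + v ^ 2), Real.sqrt_nonneg _, Real.sq_sqrt (by positivity)⟩
  obtain ⟨β, hβ0, hβ⟩ : ∃ β : ℝ, 0 ≤ β ∧ β ^ 2 = u ^ 2 + v ^ 2 :=
    ⟨√(u ^ 2 + v ^ 2), Real.sqrt_nonneg _, Real.sq_sqrt (by positivity)⟩
  -- α and β are the distances from u + iv to 1 and 0, so α + β ≥ 1; this makes c real.
  have h1 : 1 - u ≤ α := le_of_sq_le_sq (by nlinarith [sq_nonneg v]) hα0
  have h2 : u ≤ β := le_of_sq_le_sq (by nlinarith [sq_nonneg v]) hβ0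
  obtain ⟨c, hc⟩ : ∃ c : ℝ, c ^ 2 = (α + β) ^ 2 - 1 :=
    ⟨√((α + β) ^ 2 - 1), Real.sq_sqrt (by nlinarith)⟩
  -- D takes the values -β and α at 0 and 1, matching the quadratic where X(1-X) vanishes; comparing
  -- leading coefficients then fixes c².
  refine ⟨C (α + β) * X - C β, c, by compute_degree, Polynomial.funext fun y => ?_⟩
  simp only [eval_add, eval_sub, eval_mul, eval_pow, eval_X, eval_C, eval_one]
  rw [hc]
  linear_combination (y - 1) * hβ - y * hα

/-- The cofactor is nonnegative off a finite set, hence on a dense part of the interval, hence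
everywhere on it by continuity. -/
theorem nonneg_of_mul_nonneg_of_pos_on {F G L : ℝ[X]} (hF : F = L * G)
    (h : ∀ y ∈ Set.Icc (0 : ℝ) 1, 0 ≤ F.eval y) {s : Set ℝ} (hs : s.Finite)
    (hL : ∀ y ∈ Set.Ioo (0 : ℝ) 1 \ s, 0 < L.eval y) :
    ∀ y ∈ Set.Icc (0 : ℝ) 1, 0 ≤ G.eval y := by
  have hd : Dense sᶜ := hs.countable.dense_compl ℝ
  have hcl : Set.Icc (0 : ℝ) 1 ⊆ closure (Set.Ioo 0 1 \ s) := by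
    rw [← closure_Ioo zero_ne_one]
    exact closure_minimal (hd.open_subset_closure_inter isOpen_Ioo) isClosed_closure
  have hG : closure (Set.Ioo 0 1 \ s) ⊆ {y | 0 ≤ G.eval y} := by
    refine closure_minimal (fun y hy => ?_) (isClosed_le continuous_const G.continuous)
    have := h y (Set.Ioo_subset_Icc_self hy.1)
    rw [hF, eval_mul] at this
    exact nonneg_of_mul_nonneg_right this (hL y hy)
  exact fun y hy => hG (hcl hy)

/-- Strong induction on the degree, splitting off a factor at a complex root. A real root outside
(0,1) gives a linear factor that is nonnegative on [0,1] up to sign; a root inside must be double; a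
nonreal root gives a positive quadratic. -/
theorem hasLukacsForm_of_nonneg (n : ℕ) : ∀ F : ℝ[X], F.natDegree = n →
    (∀ y ∈ Set.Icc (0 : ℝ) 1, 0 ≤ F.eval y) → HasLukacsForm n F := by
  induction n using Nat.strong_induction_on with
  | _ n ih =>
  intro F hn hF
  rcases Nat.eq_zero_or_pos n with rfl | hpos
  · rw [eq_C_of_natDegree_eq_zero hn] at hF ⊢
    exact hasLukacsForm_C (by simpa using hF 0 (by simp))
  have hF0 : F ≠ 0 := by rintro rfl; simp at hn; omega
  obtain ⟨z, hz⟩ : ∃ z : ℂ, aeval z F = 0 := by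
    obtain ⟨z, hz⟩ := IsAlgClosed.exists_root (F.map (algebraMap ℝ ℂ)) (by
      rw [degree_map, degree_eq_natDegree hF0, hn]; exact_mod_cast hpos.ne')
    exact ⟨z, by rwa [IsRoot, eval_map_algebraMap] at hz⟩
  by_cases him : z.im = 0
  · obtain ⟨a, rfl⟩ : ∃ a : ℝ, z = a := ⟨z.re, Complex.ext rfl (by simpa using him)⟩
    have ha : F.eval a = 0 := by
      have := aeval_algebraMap_apply ℂ a F
      rw [Complex.coe_algebraMap, hz] at this
      simpa using this.symm
    obtain ⟨G, hG⟩ := dvd_iff_isRoot.2 ha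
    have hG0 : G ≠ 0 := by rintro rfl; simp [hF0] at hG
    have hGd : G.natDegree + 1 = n := by
      rw [← hn, hG, natDegree_mul (X_sub_C_ne_zero a) hG0, natDegree_X_sub_C, add_comm]
    rcases le_or_gt a 0 with ha0 | ha0
    · have := (ih _ (by omega) G rfl (nonneg_of_mul_nonneg_of_pos_on hG hF Set.finite_empty
        fun y hy => by
          have := hy.1.1
          simp only [eval_sub, eval_X, eval_C]; linarith)).mul_linear (α := 1 - a) (β := -a)
        (by linarith) (by linarith)
      rw [hGd] at this
      convert this using 1
      rw [hG, C_sub, C_neg, C_1]; ring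
    rcases le_or_gt 1 a with ha1 | ha1
    · have hG' : F = (C a - X) * -G := by rw [hG]; ring
      have := (ih _ (by omega) (-G) (natDegree_neg G) (nonneg_of_mul_nonneg_of_pos_on hG' hF
        Set.finite_empty fun y hy => by
          have := hy.1.2
          simp only [eval_sub, eval_X, eval_C]; linarith)).mul_linear (α := a - 1) (β := a)
        (by linarith) (by linarith)
      rw [hGd] at this
      convert this using 1
      rw [hG', C_sub, C_1]; ring
    -- F ≥ 0 forces G ≤ 0 to the left of a and G ≥ 0 to the right, so G vanishes at a.
    · have hGa : G.eval a = 0 := by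
        have key (y : ℝ) (hy : y ∈ Set.Icc (0 : ℝ) 1) : 0 ≤ (y - a) * G.eval y := by
          simpa [hG] using hF y hy
        apply le_antisymm
        · have : Set.Icc 0 a ⊆ {y | G.eval y ≤ 0} := by
            rw [← closure_Ioo ha0.ne]
            refine closure_minimal (fun y hy => ?_) (isClosed_le G.continuous continuous_const)
            have := key y ⟨hy.1.le, hy.2.le.trans ha1.le⟩
            exact nonpos_of_mul_nonneg_right this (by linarith [hy.2])
          exact this ⟨ha0.le, le_rfl⟩
        · have : Set.Icc a 1 ⊆ {y | 0 ≤ G.eval y} := by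
            rw [← closure_Ioo ha1.ne]
            refine closure_minimal (fun y hy => ?_) (isClosed_le continuous_const G.continuous)
            have := key y ⟨ha0.le.trans hy.1.le, hy.2.le⟩
            exact nonneg_of_mul_nonneg_right this (by linarith [hy.1])
          exact this ⟨le_rfl, ha1.le⟩
      obtain ⟨K, hK⟩ := dvd_iff_isRoot.2 hGa
      have hK0 : K ≠ 0 := by rintro rfl; simp [hG0] at hK
      have hKd : K.natDegree + 1 = G.natDegree := by
        rw [hK, natDegree_mul (X_sub_C_ne_zero a) hK0, natDegree_X_sub_C, add_comm]
      have hFK : F = (X - C a) ^ 2 * K := by rw [hG, hK]; ring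
      have := (ih _ (by omega) K rfl (nonneg_of_mul_nonneg_of_pos_on hFK hF
        (Set.finite_singleton a) fun y hy => by
          have : y - a ≠ 0 := sub_ne_zero.2 hy.2
          simp only [eval_pow, eval_sub, eval_X, eval_C]; positivity)).mul_quadratic
          (D := X - C a) (natDegree_X_sub_C a).le 0
      rw [show K.natDegree + 2 = n by omega] at this
      convert this using 1
      rw [hFK, C_0]; ring
  · obtain ⟨G, hG⟩ := F.quadratic_dvd_of_aeval_eq_zero_im_ne_zero hz him
    have hq : ‖z‖ ^ 2 = z.re ^ 2 + z.im ^ 2 := by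
      rw [← Complex.normSq_eq_norm_sq, Complex.normSq_apply]; ring
    rw [hq] at hG
    have hG0 : G ≠ 0 := by rintro rfl; simp [hF0] at hG
    have hqd : (X ^ 2 - C (2 * z.re) * X + C (z.re ^ 2 + z.im ^ 2)).natDegree = 2 := by
      compute_degree!
    have hGd : G.natDegree + 2 = n := by
      rw [← hn, hG, natDegree_mul (ne_zero_of_natDegree_gt (hqd.symm ▸ one_lt_two)) hG0, hqd, add_comm]
    obtain ⟨D, c, hD, hDc⟩ := quadratic_eq_lukacs z.re z.im
    have := (ih _ (by omega) G rfl (nonneg_of_mul_nonneg_of_pos_on hG hF Set.finite_empty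
      fun y hy => by
        simp only [eval_add, eval_pow, eval_sub, eval_mul, eval_X, eval_C]
        have : 0 < z.im ^ 2 := by positivity
        nlinarith [sq_nonneg (y - z.re)])).mul_quadratic hD c
    rw [hGd, ← hDc, ← hG] at this
    exact this

end IntervalPositivity

end QSVT

namespace QSVT

open Polynomial ComplexConjugate

/-! ### Quantum signal processing in the squared variable -/

section SignalProcessing

/-- The pair of polynomials in the squared singular value that describes the first `n` steps of
alternating phase reflections about two projectors, applied to the range of one of them. -/
noncomputable def signalPair (φ : ℕ → ℝ) : ℕ → ℂ[X] × ℂ[X]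
  | 0 => (1, 0)
  | n + 1 =>
    let s := signalPair φ n
    if Even n then
      (C (Complex.exp (Complex.I * φ n)) * (s.1 + (1 - X) * s.2),
        C (Complex.exp (-(Complex.I * φ n))) * (s.1 - X * s.2))
    else
      (C (Complex.exp (Complex.I * φ n)) * (X * s.1 + (1 - X) * s.2),
        C (Complex.exp (-(Complex.I * φ n))) * (s.1 - s.2))

theorem signalPair_congr {φ ψ : ℕ → ℝ} {n : ℕ} (h : ∀ i < n, φ i = ψ i) :
    signalPair φ n = signalPair ψ n := by
  induction n with
  | zero => rfl
  | succ n ih =>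
    simp only [signalPair]
    rw [ih fun i hi => h i (by omega), h n (by omega)]

/-- Apart from the phase factors the recursion has real coefficients. -/
theorem signalPair_neg (φ : ℕ → ℝ) (n : ℕ) :
    signalPair (-φ) n =
      ((signalPair φ n).1.map (starRingEnd ℂ), (signalPair φ n).2.map (starRingEnd ℂ)) := by
  induction n with
  | zero => simp [signalPair]
  | succ n ih =>
    simp only [signalPair]
    rw [ih]
    split_ifs <;> simp [← Complex.exp_conj]

/-- The unitarity and degree constraints on the pair of polynomials of `n` steps. -/
def IsUnitaryPair (n : ℕ) (p q : ℂ[X]) : Prop :=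
  (∀ k, n = 2 * k → p.degree < (k + 1 : ℕ) ∧ q.degree < (k : ℕ) ∧
    p * p.map (starRingEnd ℂ) + X * (1 - X) * (q * q.map (starRingEnd ℂ)) = 1) ∧
  (∀ k, n = 2 * k + 1 → p.degree < (k + 1 : ℕ) ∧ q.degree < (k + 1 : ℕ) ∧
    X * (p * p.map (starRingEnd ℂ)) + (1 - X) * (q * q.map (starRingEnd ℂ)) = 1)

/-- Equal moduli: half the difference of the arguments is the phase. It supplies the phase that
cancels leading coefficients. -/
theorem exists_phase_align {α β : ℂ} (h : α * conj α = β * conj β) :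
    ∃ φ : ℝ, Complex.exp (-(Complex.I * φ)) * α = Complex.exp (Complex.I * φ) * β := by
  have hn : ‖α‖ = ‖β‖ := by
    rw [Complex.mul_conj, Complex.mul_conj, Complex.normSq_eq_norm_sq,
      Complex.normSq_eq_norm_sq] at h
    exact (sq_eq_sq₀ (norm_nonneg _) (norm_nonneg _)).1 (by exact_mod_cast h)
  obtain ⟨r, a, b, rfl, rfl⟩ : ∃ r a b : ℝ, α = r * Complex.exp (a * Complex.I) ∧
      β = r * Complex.exp (b * Complex.I) :=
    ⟨‖α‖, α.arg, β.arg, (Complex.norm_mul_exp_arg_mul_I α).symm,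
      by rw [hn, Complex.norm_mul_exp_arg_mul_I]⟩
  refine ⟨(a - b) / 2, ?_⟩
  rw [mul_left_comm, mul_left_comm _ (r : ℂ), ← Complex.exp_add, ← Complex.exp_add]
  congr 2
  push_cast
  ring

theorem natDegree_le_of_degree_lt_succ {R : Type*} [Semiring R] {p : R[X]} {k : ℕ}
    (h : p.degree < (k + 1 : ℕ)) : p.natDegree ≤ k :=
  natDegree_le_iff_degree_le.2 (Order.le_of_lt_succ h)

theorem degree_lt_of_coeff_eq_zero {R : Type*} [Semiring R] {p : R[X]} {k : ℕ}
    (h : p.degree < (k + 1 : ℕ)) (h0 : p.coeff k = 0) : p.degree < (k : ℕ) := by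
  rw [degree_lt_iff_coeff_zero] at h ⊢
  intro m hm
  rcases hm.eq_or_lt with rfl | hm
  · exact h0
  · exact h m hm

theorem coeff_mul_map_conj {p : ℂ[X]} {k : ℕ} (h : p.natDegree ≤ k) :
    (p * p.map (starRingEnd ℂ)).coeff (k + k) = p.coeff k * conj (p.coeff k) := by
  rw [coeff_mul_add_eq_of_natDegree_le h (natDegree_map_le.trans h), coeff_map]

theorem natDegree_mul_map_conj_le {p : ℂ[X]} {k : ℕ} (h : p.natDegree ≤ k) :
    (p * p.map (starRingEnd ℂ)).natDegree ≤ k + k :=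
  natDegree_mul_le_of_le h (natDegree_map_le.trans h)

theorem coeff_one_one_sub_X : (1 - X : ℂ[X]).coeff 1 = -1 := by
  simp [coeff_one]

theorem C_mul_mul_map_conj (c : ℂ) (hc : c * conj c = 1) (p : ℂ[X]) :
    C c * p * (C c * p).map (starRingEnd ℂ) = p * p.map (starRingEnd ℂ) := by
  have : C c * C (conj c) = 1 := by rw [← C_mul, hc, C_1]
  rw [Polynomial.map_mul, map_C]
  linear_combination p * p.map (starRingEnd ℂ) * this

theorem exp_mul_conj_exp (φ : ℝ) :
    Complex.exp (Complex.I * φ) * conj (Complex.exp (Complex.I * φ)) = 1 := by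
  rw [← Complex.exp_conj, ← Complex.exp_add]; simp

theorem exp_neg_mul_conj_exp (φ : ℝ) :
    Complex.exp (-(Complex.I * φ)) * conj (Complex.exp (-(Complex.I * φ))) = 1 := by
  rw [← Complex.exp_conj, ← Complex.exp_add]; simp

theorem C_exp_mul_C_exp_neg (φ : ℝ) :
    C (Complex.exp (Complex.I * φ)) * C (Complex.exp (-(Complex.I * φ))) = 1 := by
  rw [← C_mul, ← Complex.exp_add]; simp

/-- The last of an even number of steps can be undone. -/
theorem IsUnitaryPair.exists_pred_of_even {k : ℕ} {p q : ℂ[X]}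
    (h : IsUnitaryPair (2 * k + 2) p q) : ∃ (φ : ℝ) (p₀ q₀ : ℂ[X]),
      IsUnitaryPair (2 * k + 1) p₀ q₀ ∧
      p = C (Complex.exp (Complex.I * φ)) * (X * p₀ + (1 - X) * q₀) ∧
      q = C (Complex.exp (-(Complex.I * φ))) * (p₀ - q₀) := by
  obtain ⟨hp, hq, hpq⟩ := h.1 (k + 1) (by ring)
  have hp' := natDegree_le_of_degree_lt_succ hp
  have hq' := natDegree_le_of_degree_lt_succ hq
  -- The unitarity identity has no term of degree 2k + 2, and X(1-X) has leading coefficient -1.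
  have hc : p.coeff (k + 1) * conj (p.coeff (k + 1)) = q.coeff k * conj (q.coeff k) := by
    have := congrArg (fun r => coeff r (k + 1 + (k + 1))) hpq
    simp only [coeff_add, coeff_mul_map_conj hp'] at this
    rw [show k + 1 + (k + 1) = 2 + (k + k) by ring,
      coeff_mul_add_eq_of_natDegree_le natDegree_X_mul_one_sub_X_le
        (natDegree_mul_map_conj_le hq'), coeff_mul_map_conj hq', coeff_X_mul, coeff_one_one_sub_X,
      coeff_one, if_neg (by omega)] at this
    linear_combination this
  obtain ⟨φ, hφ⟩ := exists_phase_align hc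
  have ee := C_exp_mul_C_exp_neg φ
  have hP := C_mul_mul_map_conj _ (exp_neg_mul_conj_exp φ) p
  have hQ := C_mul_mul_map_conj _ (exp_mul_conj_exp φ) q
  have hPd := degree_mul_lt (natDegree_C (Complex.exp (-(Complex.I * φ)))).le hp (zero_add _).le
  have hQd := degree_mul_lt (natDegree_C (Complex.exp (Complex.I * φ))).le hq (zero_add _).le
  have hPQ : (C (Complex.exp (-(Complex.I * φ))) * p).coeff (k + 1) =
      (C (Complex.exp (Complex.I * φ)) * q).coeff k := by rwa [coeff_C_mul, coeff_C_mul]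
  have hp_eq : p = C (Complex.exp (Complex.I * φ)) * (C (Complex.exp (-(Complex.I * φ))) * p) := by
    rw [← mul_assoc, ee, one_mul]
  have hq_eq : q = C (Complex.exp (-(Complex.I * φ))) * (C (Complex.exp (Complex.I * φ)) * q) := by
    rw [← mul_assoc, mul_comm (C _) (C _), ee, one_mul]
  -- The witnesses invert the step. Both a priori have degree up to k + 1, but their top
  -- coefficients cancel by the choice of φ.
  refine ⟨φ, C (Complex.exp (-(Complex.I * φ))) * p +
      (1 - X) * (C (Complex.exp (Complex.I * φ)) * q),
    C (Complex.exp (-(Complex.I * φ))) * p - X * (C (Complex.exp (Complex.I * φ)) * q), ?_,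
    hp_eq.trans (by ring), hq_eq.trans (by ring)⟩
  rw [← hP, ← hQ] at hpq
  generalize C (Complex.exp (-(Complex.I * φ))) * p = P at *
  generalize C (Complex.exp (Complex.I * φ)) * q = Q at *
  refine ⟨fun j hj => by omega, fun j hj => ?_⟩
  obtain rfl : k = j := by omega
  have hQ0 : Q.coeff (k + 1) = 0 := coeff_eq_zero_of_degree_lt hQd
  refine ⟨degree_lt_of_coeff_eq_zero (degree_add_lt hPd
      (degree_mul_lt natDegree_one_sub_X_le hQd (by omega))) ?_,
    degree_lt_of_coeff_eq_zero (degree_sub_lt_of_lt hPd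
      (degree_mul_lt natDegree_X_le hQd (by omega))) ?_, ?_⟩
  · rw [sub_mul, one_mul, coeff_add, coeff_sub, coeff_X_mul, hPQ, hQ0]; ring
  · rw [coeff_sub, coeff_X_mul, hPQ, sub_self]
  · refine Eq.trans ?_ hpq
    simp only [Polynomial.map_add, Polynomial.map_sub, Polynomial.map_mul, map_X,
      Polynomial.map_one]
    ring

/-- The last of an odd number of steps can be undone. -/
theorem IsUnitaryPair.exists_pred_of_odd {k : ℕ} {p q : ℂ[X]}
    (h : IsUnitaryPair (2 * k + 1) p q) : ∃ (φ : ℝ) (p₀ q₀ : ℂ[X]),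
      IsUnitaryPair (2 * k) p₀ q₀ ∧
      p = C (Complex.exp (Complex.I * φ)) * (p₀ + (1 - X) * q₀) ∧
      q = C (Complex.exp (-(Complex.I * φ))) * (p₀ - X * q₀) := by
  obtain ⟨hp, hq, hpq⟩ := h.2 k rfl
  have hp' := natDegree_le_of_degree_lt_succ hp
  have hq' := natDegree_le_of_degree_lt_succ hq
  have hc : p.coeff k * conj (p.coeff k) = q.coeff k * conj (q.coeff k) := by
    have := congrArg (fun r => coeff r (1 + (k + k))) hpq
    simp only [coeff_add] at this
    rw [coeff_mul_add_eq_of_natDegree_le natDegree_X_le (natDegree_mul_map_conj_le hp'),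
      coeff_mul_add_eq_of_natDegree_le natDegree_one_sub_X_le (natDegree_mul_map_conj_le hq'),
      coeff_mul_map_conj hp', coeff_mul_map_conj hq', coeff_one_one_sub_X, coeff_X_one,
      coeff_one, if_neg (by omega)] at this
    linear_combination this
  obtain ⟨φ, hφ⟩ := exists_phase_align hc
  have ee := C_exp_mul_C_exp_neg φ
  have hP := C_mul_mul_map_conj _ (exp_neg_mul_conj_exp φ) p
  have hQ := C_mul_mul_map_conj _ (exp_mul_conj_exp φ) q
  have hPd := degree_mul_lt (natDegree_C (Complex.exp (-(Complex.I * φ)))).le hp (zero_add _).le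
  have hQd := degree_mul_lt (natDegree_C (Complex.exp (Complex.I * φ))).le hq (zero_add _).le
  have hPQ : (C (Complex.exp (-(Complex.I * φ))) * p).coeff k =
      (C (Complex.exp (Complex.I * φ)) * q).coeff k := by rwa [coeff_C_mul, coeff_C_mul]
  have hp_eq : p = C (Complex.exp (Complex.I * φ)) * (C (Complex.exp (-(Complex.I * φ))) * p) := by
    rw [← mul_assoc, ee, one_mul]
  have hq_eq : q = C (Complex.exp (-(Complex.I * φ))) * (C (Complex.exp (Complex.I * φ)) * q) := by
    rw [← mul_assoc, mul_comm (C _) (C _), ee, one_mul]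
  -- Again the inverse of the step, with the degree reduced by the alignment of the top
  -- coefficients.
  refine ⟨φ, X * (C (Complex.exp (-(Complex.I * φ))) * p) +
      (1 - X) * (C (Complex.exp (Complex.I * φ)) * q),
    C (Complex.exp (-(Complex.I * φ))) * p - C (Complex.exp (Complex.I * φ)) * q, ?_,
    hp_eq.trans (by ring), hq_eq.trans (by ring)⟩
  rw [← hP, ← hQ] at hpq
  generalize C (Complex.exp (-(Complex.I * φ))) * p = P at *
  generalize C (Complex.exp (Complex.I * φ)) * q = Q at *
  refine ⟨fun j hj => ?_, fun j hj => by omega⟩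
  obtain rfl : k = j := by omega
  have hQ0 : Q.coeff (k + 1) = 0 := coeff_eq_zero_of_degree_lt hQd
  refine ⟨degree_lt_of_coeff_eq_zero (degree_add_lt (degree_mul_lt natDegree_X_le hPd (by omega))
      (degree_mul_lt natDegree_one_sub_X_le hQd (by omega))) ?_,
    degree_lt_of_coeff_eq_zero (degree_sub_lt_of_lt hPd hQd) ?_, ?_⟩
  · rw [sub_mul, one_mul, coeff_add, coeff_sub, coeff_X_mul, coeff_X_mul, hPQ, hQ0]; ring
  · rw [coeff_sub, hPQ, sub_self]
  · refine Eq.trans ?_ hpq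
    simp only [Polynomial.map_add, Polynomial.map_sub, Polynomial.map_mul, map_X,
      Polynomial.map_one]
    ring

theorem IsUnitaryPair.exists_pred {n : ℕ} {p q : ℂ[X]} (h : IsUnitaryPair (n + 1) p q) :
    ∃ (φ : ℝ) (p₀ q₀ : ℂ[X]), IsUnitaryPair n p₀ q₀ ∧
      (p, q) = if Even n then
        (C (Complex.exp (Complex.I * φ)) * (p₀ + (1 - X) * q₀),
          C (Complex.exp (-(Complex.I * φ))) * (p₀ - X * q₀))
      else
        (C (Complex.exp (Complex.I * φ)) * (X * p₀ + (1 - X) * q₀),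
          C (Complex.exp (-(Complex.I * φ))) * (p₀ - q₀)) := by
  obtain ⟨k, rfl | rfl⟩ := n.even_or_odd'
  · obtain ⟨φ, p₀, q₀, h0, hp, hq⟩ := h.exists_pred_of_odd
    exact ⟨φ, p₀, q₀, h0, by rw [if_pos (by simp), ← hp, ← hq]⟩
  · obtain ⟨φ, p₀, q₀, h0, hp, hq⟩ := h.exists_pred_of_even
    exact ⟨φ, p₀, q₀, h0, by rw [if_neg (by simp), ← hp, ← hq]⟩

/-- Peeling off steps ends at a unimodular constant and q = 0; that constant is the global phase θ.
-/
theorem IsUnitaryPair.exists_signalPair_eq {n : ℕ} {p q : ℂ[X]} (h : IsUnitaryPair n p q) :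
    ∃ (φ : ℕ → ℝ) (θ : ℝ),
      (p, q) = (C (Complex.exp (Complex.I * θ)) * (signalPair φ n).1,
        C (Complex.exp (Complex.I * θ)) * (signalPair φ n).2) := by
  induction n generalizing p q with
  | zero =>
    obtain ⟨hp, hq, hpq⟩ := h.1 0 rfl
    have hq0 : q = 0 := by
      by_contra hne
      rw [degree_eq_natDegree hne] at hq
      exact absurd (Nat.cast_lt.1 hq) (Nat.not_lt_zero _)
    obtain ⟨c, rfl⟩ : ∃ c, p = C c :=
      ⟨_, eq_C_of_natDegree_le_zero (natDegree_le_of_degree_lt_succ hp)⟩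
    subst hq0
    have hc : c * conj c = 1 * conj 1 := by
      apply C_injective
      simpa using hpq
    have hn : ‖c‖ = 1 := by
      rw [Complex.mul_conj, Complex.normSq_eq_norm_sq, map_one, mul_one] at hc
      exact (pow_eq_one_iff_of_nonneg (norm_nonneg c) two_ne_zero).1 (by exact_mod_cast hc)
    refine ⟨0, c.arg, ?_⟩
    have := Complex.norm_mul_exp_arg_mul_I c
    rw [hn, Complex.ofReal_one, one_mul, mul_comm] at this
    simp [signalPair, this]
  | succ n ih =>
    obtain ⟨φ, p₀, q₀, h0, hpq⟩ := h.exists_pred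
    obtain ⟨ψ, θ, hψ⟩ := ih h0
    obtain ⟨rfl, rfl⟩ := Prod.mk.inj hψ
    refine ⟨Function.update ψ n φ, θ, hpq.trans ?_⟩
    have hc : signalPair (Function.update ψ n φ) n = signalPair ψ n :=
      signalPair_congr fun i hi => Function.update_of_ne hi.ne _ _
    simp only [signalPair, hc, Function.update_self]
    split_ifs <;> exact Prod.ext (by ring) (by ring)

/-- Quantum signal processing: the first polynomial of a unitary pair is realized by phases. -/
theorem IsUnitaryPair.exists_signalPair_fst_eq {n : ℕ} {p q : ℂ[X]} (hn : n ≠ 0)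
    (h : IsUnitaryPair n p q) : ∃ φ : ℕ → ℝ, (signalPair φ n).1 = p := by
  obtain ⟨φ, θ, hφ⟩ := h.exists_signalPair_eq
  obtain ⟨n, rfl⟩ := Nat.exists_eq_succ_of_ne_zero hn
  -- The last phase absorbs θ in the first component; the second component is not preserved, nor
  -- needed.
  refine ⟨Function.update φ n (φ n + θ), ?_⟩
  have hc : signalPair (Function.update φ n (φ n + θ)) n = signalPair φ n :=
    signalPair_congr fun i hi => Function.update_of_ne hi.ne _ _
  have he : Complex.exp (Complex.I * (φ n + θ : ℝ)) =
      Complex.exp (Complex.I * θ) * Complex.exp (Complex.I * φ n) := by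
    rw [← Complex.exp_add]; push_cast; ring_nf
  rw [(Prod.mk.inj hφ).1]
  simp only [signalPair, hc, Function.update_self, he, C_mul]
  split_ifs <;> ring

/-- A real polynomial bounded by `1` on `[0, 1]` is the real part of the polynomial of some
sequence of phases. -/
theorem exists_phases_of_abs_le_one {P : ℝ[X]} (hP : P.natDegree ≠ 0)
    (h : ∀ y ∈ Set.Icc (0 : ℝ) 1, |P.eval y| ≤ 1) :
    ∃ φ : ℕ → ℝ, (signalPair φ (2 * P.natDegree)).1 + (signalPair (-φ) (2 * P.natDegree)).1 =
      C 2 * P.map (algebraMap ℝ ℂ) := by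
  have hdeg : (1 - P ^ 2).natDegree = 2 * P.natDegree := by
    rw [natDegree_sub_eq_right_of_natDegree_lt, natDegree_pow]
    rw [natDegree_pow, natDegree_one]; omega
  obtain ⟨B, D, hB, hD, hBD⟩ := (hasLukacsForm_of_nonneg _ _ hdeg fun y hy => by
    have := (sq_le_one_iff_abs_le_one _).2 (h y hy)
    simpa using this).1 _ rfl
  have hmap (F : ℝ[X]) :
      (F.map (algebraMap ℝ ℂ)).map (starRingEnd ℂ) = F.map (algebraMap ℝ ℂ) := by
    rw [Polynomial.map_map]
    congr 1
    ext x; simp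
  have hII : C Complex.I * C Complex.I = -1 := by
    rw [← C_mul, Complex.I_mul_I, C_neg, C_1]
  -- With P and B real, (P + iB)(P - iB) = P² + B², so the certificate of 1 - P² is the unitarity
  -- identity.
  have hu : IsUnitaryPair (2 * P.natDegree)
      (P.map (algebraMap ℝ ℂ) + C Complex.I * B.map (algebraMap ℝ ℂ))
      (D.map (algebraMap ℝ ℂ)) := by
    refine ⟨fun k hk => ?_, fun k hk => by omega⟩
    obtain rfl : P.natDegree = k := by omega
    refine ⟨degree_add_lt ?_ (degree_mul_lt (natDegree_C _).le (n := P.natDegree + 1) ?_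
      (zero_add _).le), ?_, ?_⟩
    · rw [degree_map]
      exact degree_le_natDegree.trans_lt (by exact_mod_cast Nat.lt_succ_self _)
    · rwa [degree_map]
    · rwa [degree_map]
    · have := congrArg (Polynomial.map (algebraMap ℝ ℂ)) hBD
      simp only [Polynomial.map_add, Polynomial.map_sub, Polynomial.map_mul, map_X,
        Polynomial.map_one, Polynomial.map_pow, hmap, map_C, Complex.conj_I, C_neg] at this ⊢
      linear_combination -this - (B.map (algebraMap ℝ ℂ)) ^ 2 * hII
  obtain ⟨φ, hφ⟩ := hu.exists_signalPair_fst_eq (by omega)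
  refine ⟨φ, ?_⟩
  rw [signalPair_neg, hφ]
  simp only [Polynomial.map_add, Polynomial.map_mul, hmap, map_C, Complex.conj_I, C_neg]
  rw [show (2 : ℂ) = 1 + 1 by norm_num, C_add, C_1]
  ring

end SignalProcessing

end QSVT

namespace QSVT

open Polynomial

/-! ### Eliminating the auxiliary qubit -/

section CircuitReduction

variable {H : Type*} [NormedAddCommGroup H] [InnerProductSpace ℂ H]

/-- The phase reflection `e^{iφ(2E - 1)}` about the range of the projector `E`. -/
noncomputable def phaseOp (E : Module.End ℂ H) (φ : ℝ) : Module.End ℂ H :=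
  Complex.exp (Complex.I * φ) • E + Complex.exp (-(Complex.I * φ)) • (1 - E)

theorem pauliX_ketVec_zero : pauliX (ketVec 0) = ketVec 1 := by
  ext i; fin_cases i <;> simp [pauliX, ketVec, Matrix.toLpLin_apply]

theorem pauliX_ketVec_one : pauliX (ketVec 1) = ketVec 0 := by
  ext i; fin_cases i <;> simp [pauliX, ketVec, Matrix.toLpLin_apply]

theorem rotZ_ketVec_zero (φ : ℝ) :
    rotZ (-2 * φ) (ketVec 0) = Complex.exp (Complex.I * φ) • ketVec 0 := by
  ext i; fin_cases i <;> simp [rotZ, ketVec, Matrix.toLpLin_apply, neg_div]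

theorem rotZ_ketVec_one (φ : ℝ) :
    rotZ (-2 * φ) (ketVec 1) = Complex.exp (-(Complex.I * φ)) • ketVec 1 := by
  ext i; fin_cases i <;> simp [rotZ, ketVec, Matrix.toLpLin_apply, neg_div]

theorem hadamard_ketVec_zero :
    hadamard (ketVec 0) = ((Real.sqrt 2 : ℝ) : ℂ)⁻¹ • (ketVec 0 + ketVec 1) := by
  ext i; fin_cases i <;> simp [hadamard, ketVec, Matrix.toLpLin_apply]

theorem hadamard_ketVec_one :
    hadamard (ketVec 1) = ((Real.sqrt 2 : ℝ) : ℂ)⁻¹ • (ketVec 0 - ketVec 1) := by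
  ext i; fin_cases i <;> simp [hadamard, ketVec, Matrix.toLpLin_apply]

theorem inner_ketVec (a b : Fin 2) :
    inner ℂ (ketVec a) (ketVec b) = if a = b then (1 : ℂ) else 0 := by
  fin_cases a <;> fin_cases b <;> simp [ketVec, EuclideanSpace.inner_single_left]

theorem braB_tmul (b : Fin 2) (x : H) (w : Qubit) :
    braB b (x ⊗ₜ[ℂ] w) = inner ℂ (ketVec b) w • x := by
  simp [braB]

theorem controlledX_tmul (E : Module.End ℂ H) (x : H) (w : Qubit) :
    controlledX E (x ⊗ₜ w) = E x ⊗ₜ pauliX w + (x - E x) ⊗ₜ w := by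
  simp [controlledX, onSystem, onB]

/-- On the range of E the qubit is flipped, rotated as |1⟩ and flipped back; on the kernel it is
rotated as |0⟩. The two parts thus receive opposite phases. -/
theorem phaseReflection_tmul_zero {E : Module.End ℂ H} (hE : E * E = E) (φ : ℝ) (x : H) :
    phaseReflection E φ (x ⊗ₜ ketVec 0) = phaseOp E (-φ) x ⊗ₜ ketVec 0 := by
  have hEE (y : H) : E (E y) = E y := LinearMap.congr_fun hE y
  simp only [phaseReflection, Module.End.mul_apply, controlledX_tmul, map_add, onB,
    TensorProduct.map_tmul, pauliX_ketVec_zero, pauliX_ketVec_one, rotZ_ketVec_zero,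
    rotZ_ketVec_one, TensorProduct.tmul_smul, map_smul, hEE, LinearMap.id_apply, map_sub, sub_self,
    TensorProduct.zero_tmul, zero_add, add_zero, sub_zero, phaseOp, LinearMap.add_apply,
    LinearMap.smul_apply, LinearMap.sub_apply, Module.End.one_apply, TensorProduct.add_tmul,
    ← TensorProduct.smul_tmul', Complex.ofReal_neg, mul_neg, neg_neg]

theorem phaseReflection_tmul_one {E : Module.End ℂ H} (hE : E * E = E) (φ : ℝ) (x : H) :
    phaseReflection E φ (x ⊗ₜ ketVec 1) = phaseOp E φ x ⊗ₜ ketVec 1 := by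
  have hEE (y : H) : E (E y) = E y := LinearMap.congr_fun hE y
  simp only [phaseReflection, Module.End.mul_apply, controlledX_tmul, map_add, onB,
    TensorProduct.map_tmul, pauliX_ketVec_zero, pauliX_ketVec_one, rotZ_ketVec_zero,
    rotZ_ketVec_one, TensorProduct.tmul_smul, map_smul, hEE, LinearMap.id_apply, map_sub, sub_self,
    TensorProduct.zero_tmul, zero_add, add_zero, sub_zero, phaseOp, LinearMap.add_apply,
    LinearMap.smul_apply, LinearMap.sub_apply, Module.End.one_apply, TensorProduct.add_tmul,
    ← TensorProduct.smul_tmul']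

variable [FiniteDimensional ℂ H]

/-- The first `n` steps of the circuit, restricted to one state of the qubit. -/
noncomputable def phaseProd (O E E' : Module.End ℂ H) (φ : ℕ → ℝ) : ℕ → Module.End ℂ H
  | 0 => 1
  | n + 1 =>
    (if Even n then phaseOp E' (φ n) * O else phaseOp E (φ n) * LinearMap.adjoint O) *
      phaseProd O E E' φ n

theorem reverse_prod_ofFn_succ {M : Type*} [Monoid M] (f : ℕ → M) (n : ℕ) :
    (List.ofFn fun j : Fin (n + 1) => f j).reverse.prod =
      f n * (List.ofFn fun j : Fin n => f j).reverse.prod := by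
  rw [List.ofFn_succ_last]
  simp

theorem steps_tmul_zero {O E E' : Module.End ℂ H} (hE : E * E = E) (hE' : E' * E' = E')
    (φ : ℕ → ℝ) (n : ℕ) (x : H) :
    (List.ofFn fun j : Fin n => step O E E' ((j : ℕ) + 1) (φ j)).reverse.prod (x ⊗ₜ ketVec 0) =
      phaseProd O E E' (-φ) n x ⊗ₜ ketVec 0 := by
  induction n with
  | zero => simp [phaseProd]
  | succ n ih =>
    rw [reverse_prod_ofFn_succ (fun j => step O E E' (j + 1) (φ j)), Module.End.mul_apply, ih]
    simp only [step, phaseProd, Nat.odd_add_one, Nat.not_odd_iff_even, Pi.neg_apply]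
    split_ifs
    · rw [Module.End.mul_apply, onSystem, TensorProduct.map_tmul, LinearMap.id_apply,
        phaseReflection_tmul_zero hE']; rfl
    · rw [Module.End.mul_apply, onSystem, TensorProduct.map_tmul, LinearMap.id_apply,
        phaseReflection_tmul_zero hE]; rfl

theorem steps_tmul_one {O E E' : Module.End ℂ H} (hE : E * E = E) (hE' : E' * E' = E')
    (φ : ℕ → ℝ) (n : ℕ) (x : H) :
    (List.ofFn fun j : Fin n => step O E E' ((j : ℕ) + 1) (φ j)).reverse.prod (x ⊗ₜ ketVec 1) =
      phaseProd O E E' φ n x ⊗ₜ ketVec 1 := by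
  induction n with
  | zero => simp [phaseProd]
  | succ n ih =>
    rw [reverse_prod_ofFn_succ (fun j => step O E E' (j + 1) (φ j)), Module.End.mul_apply, ih]
    simp only [step, phaseProd, Nat.odd_add_one, Nat.not_odd_iff_even]
    split_ifs
    · rw [Module.End.mul_apply, onSystem, TensorProduct.map_tmul, LinearMap.id_apply,
        phaseReflection_tmul_one hE']; rfl
    · rw [Module.End.mul_apply, onSystem, TensorProduct.map_tmul, LinearMap.id_apply,
        phaseReflection_tmul_one hE]; rfl

/-- The Hadamards prepare and test (|0⟩ + |1⟩)/√2, and the steps never mix the qubit states, so only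
the mean of the two branches survives. -/
theorem circuitBlock_eq {O E E' : Module.End ℂ H} (hE : E * E = E) (hE' : E' * E' = E')
    (φ : ℕ → ℝ) (d : ℕ) :
    circuitBlock O E E' (fun j : Fin d => φ j) =
      (2⁻¹ : ℂ) • (E * phaseProd O E E' φ d * E + E * phaseProd O E E' (-φ) d * E) := by
  have hs : ((Real.sqrt 2 : ℝ) : ℂ)⁻¹ * ((Real.sqrt 2 : ℝ) : ℂ)⁻¹ = 2⁻¹ := by
    rw [← mul_inv, ← Complex.ofReal_mul, Real.mul_self_sqrt (by norm_num)]; norm_num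
  ext x
  simp only [circuitBlock, circuit, LinearMap.comp_apply, Module.End.mul_apply, ketB,
    LinearMap.flip_apply, TensorProduct.mk_apply]
  simp only [onSystem, onB, TensorProduct.map_tmul, LinearMap.id_apply, hadamard_ketVec_zero,
    TensorProduct.tmul_smul, TensorProduct.tmul_add, map_smul, map_add,
    steps_tmul_zero hE hE', steps_tmul_one hE hE', hadamard_ketVec_one, TensorProduct.tmul_sub,
    map_sub, braB_tmul, inner_ketVec, LinearMap.smul_apply, LinearMap.add_apply,
    Module.End.mul_apply, ← hs, if_true, zero_ne_one, if_false]
  module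

end CircuitReduction

/-! ### Alternating reflections about two projectors -/

section TwoProjectors

variable {H : Type*} [NormedAddCommGroup H] [InnerProductSpace ℂ H]

theorem commute_aeval {R A : Type*} [CommSemiring R] [Semiring A] [Algebra R A] {a b : A}
    (h : Commute a b) (p : R[X]) : Commute a (aeval b p) := by
  induction p using Polynomial.induction_on' with
  | add p q hp hq => rw [map_add]; exact hp.add_right hq
  | monomial n c =>
    rw [aeval_monomial]
    exact (Algebra.commute_algebraMap_right c a).mul_right (h.pow_right n)

theorem phaseOp_mul_left {E : Module.End ℂ H} (hE : E * E = E) (φ : ℝ) (A B : Module.End ℂ H) :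
    phaseOp E φ * (E * A + (1 - E) * B) =
      Complex.exp (Complex.I * φ) • (E * A) + Complex.exp (-(Complex.I * φ)) • ((1 - E) * B) := by
  have hE1 : E * (1 - E) = 0 := by rw [mul_sub, hE, mul_one, sub_self]
  have hE2 : (1 - E) * E = 0 := by rw [sub_mul, hE, one_mul, sub_self]
  have hE3 : (1 - E) * (1 - E) = 1 - E := by rw [mul_sub, hE2, mul_one, sub_zero]
  simp only [phaseOp, add_mul, mul_add, smul_mul_assoc, ← mul_assoc, hE, hE1, hE2, hE3,
    add_zero, zero_add, smul_zero]

/-- Change of frame from the splitting by E to the splitting by S, where the next reflection is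
diagonal; the coefficients are those of the recursion at X = ESE. -/
theorem evenPart_eq {E S a b : Module.End ℂ H} (hE : E * E = E) :
    E * a + (1 - E) * (S * E * b) =
      S * (E * (a + (1 - E * S * E) * b)) + (1 - S) * (E * (a - E * S * E * b)) := by
  have hEx (x : Module.End ℂ H) : E * (E * x) = E * x := by rw [← mul_assoc, hE]
  simp only [mul_add, mul_sub, sub_mul, one_mul, mul_assoc, hEx]
  abel

/-- The change of frame back from S to E. -/
theorem oddPart_eq {E S a b : Module.End ℂ H} (hE : E * E = E) :
    S * (E * a) + (1 - S) * (E * b) =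
      E * (E * S * E * a + (1 - E * S * E) * b) + (1 - E) * (S * E * (a - b)) := by
  have hEx (x : Module.End ℂ H) : E * (E * x) = E * x := by rw [← mul_assoc, hE]
  simp only [mul_add, mul_sub, sub_mul, one_mul, mul_assoc, hEx]
  abel

variable [FiniteDimensional ℂ H]

/-- The action of the circuit on the range of `E`, in terms of the projectors `E` and
`S = O† E' O`. -/
theorem phaseProd_mul {O E E' S : Module.End ℂ H} (hO : O ∈ unitary (Module.End ℂ H))
    (hE : E * E = E) (hE' : E' * E' = E') (hS : S = LinearMap.adjoint O * E' * O)
    (φ : ℕ → ℝ) (n : ℕ) :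
    phaseProd O E E' φ n * E =
      if Even n then
        E * aeval (E * S * E) (signalPair φ n).1 +
          (1 - E) * (S * E * aeval (E * S * E) (signalPair φ n).2)
      else
        O * (S * (E * aeval (E * S * E) (signalPair φ n).1) +
          (1 - S) * (E * aeval (E * S * E) (signalPair φ n).2)) := by
  have hO1 : LinearMap.adjoint O * O = 1 := hO.1
  have hO2 : O * LinearMap.adjoint O = 1 := hO.2
  have hE'O : E' * O = O * S := by rw [hS, ← mul_assoc, ← mul_assoc, hO2, one_mul]
  have hSS : S * S = S := by
    calc S * S = LinearMap.adjoint O * (E' * O) * S := by rw [hS]; simp only [mul_assoc]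
      _ = LinearMap.adjoint O * O * (S * S) := by rw [hE'O]; simp only [mul_assoc]
      _ = LinearMap.adjoint O * (O * S) * S := by simp only [mul_assoc]
      _ = LinearMap.adjoint O * (E' * (E' * O)) := by
        rw [← hE'O]; simp only [mul_assoc]; rw [← hE'O]
      _ = S := by rw [← mul_assoc E', hE', hS, mul_assoc]
  -- Moving O to the left turns reflections about E' into reflections about S.
  have hphase (ψ : ℝ) : phaseOp E' ψ * O = O * phaseOp S ψ := by
    simp only [phaseOp, add_mul, mul_add, smul_mul_assoc, mul_smul_comm, sub_mul, mul_sub, one_mul,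
      mul_one, hE'O]
  induction n with
  | zero => simp [phaseProd, signalPair]
  | succ n ih =>
    rw [phaseProd, mul_assoc, ih]
    simp only [Nat.even_add_one]
    by_cases hn : Even n
    · simp only [hn, signalPair, if_true, not_true, if_false]
      rw [evenPart_eq hE, hphase, mul_assoc, phaseOp_mul_left hSS]
      simp only [map_mul, map_add, map_sub, map_one, aeval_X, aeval_C,
        Algebra.algebraMap_eq_smul_one, smul_mul_assoc, one_mul, mul_smul_comm]
    · simp only [hn, signalPair, if_false, not_false_eq_true, if_true]
      rw [mul_assoc, ← mul_assoc _ O, hO1, one_mul, oddPart_eq hE, phaseOp_mul_left hE]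
      simp only [map_mul, map_add, map_sub, map_one, aeval_X, aeval_C,
        Algebra.algebraMap_eq_smul_one, smul_mul_assoc, one_mul, mul_smul_comm]

/-- The left factor E kills the (1-E) component, leaving only the first polynomial, which commutes
with E. -/
theorem mul_phaseProd_mul {O E E' : Module.End ℂ H} (hO : O ∈ unitary (Module.End ℂ H))
    (hE : E * E = E) (hE' : E' * E' = E') (φ : ℕ → ℝ) {n : ℕ} (hn : Even n) :
    E * phaseProd O E E' φ n * E =
      aeval (E * LinearMap.adjoint O * E' * E' * O * E) (signalPair φ n).1 * E := by
  have hM : E * LinearMap.adjoint O * E' * E' * O * E =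
      E * (LinearMap.adjoint O * E' * O) * E := by
    simp only [mul_assoc]; rw [← mul_assoc E' E', hE']
  have hcomm : Commute E (E * (LinearMap.adjoint O * E' * O) * E) := by
    rw [Commute, SemiconjBy, ← mul_assoc, ← mul_assoc, hE, mul_assoc _ E E, hE]
  rw [mul_assoc, phaseProd_mul hO hE hE' rfl, if_pos hn, mul_add, ← mul_assoc, ← mul_assoc E (1 - E),
    hE, mul_sub, mul_one, hE, sub_self, zero_mul, add_zero, hM]
  exact commute_aeval hcomm _

theorem circuitBlock_eq_aeval {O E E' : Module.End ℂ H} (hO : O ∈ unitary (Module.End ℂ H))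
    (hE : E * E = E) (hE' : E' * E' = E') {P : ℝ[X]} {φ : ℕ → ℝ} {n : ℕ} (hn : Even n)
    (hφ : (signalPair φ n).1 + (signalPair (-φ) n).1 = C 2 * P.map (algebraMap ℝ ℂ)) :
    circuitBlock O E E' (fun j : Fin n => φ j) =
      aeval (E * LinearMap.adjoint O * E' * E' * O * E) (P.map (algebraMap ℝ ℂ)) * E := by
  rw [circuitBlock_eq hE hE', mul_phaseProd_mul hO hE hE' _ hn, mul_phaseProd_mul hO hE hE' _ hn,
    ← add_mul, ← map_add, hφ, map_mul, aeval_C, Algebra.algebraMap_eq_smul_one, smul_mul_assoc,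
    one_mul, smul_mul_assoc, smul_smul, inv_mul_cancel₀ two_ne_zero, one_smul]

end TwoProjectors

end QSVT

namespace QSVT

open Module Polynomial

/-! ### Singular values and the even transform -/

section SingularValues

/-- The singular value decomposition of a linear map between finite-dimensional spaces, with the
singular values in increasing order. -/
theorem exists_monotone_svd {V W : Type*} [NormedAddCommGroup V] [InnerProductSpace ℂ V]
    [FiniteDimensional ℂ V] [NormedAddCommGroup W] [InnerProductSpace ℂ W]
    [FiniteDimensional ℂ W] (T : V →ₗ[ℂ] W) :
    ∃ (ψ : OrthonormalBasis (Fin (finrank ℂ V)) ℂ V)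
      (ψ' : OrthonormalBasis (Fin (finrank ℂ W)) ℂ W)
      (ζ : Fin (min (finrank ℂ V) (finrank ℂ W)) → ℝ),
      (∀ j, 0 ≤ ζ j) ∧ Monotone ζ ∧
      (∀ j, T (ψ (j.castLE (min_le_left _ _))) = (ζ j : ℂ) • ψ' (j.castLE (min_le_right _ _))) ∧
      ∀ i : Fin (finrank ℂ V), min (finrank ℂ V) (finrank ℂ W) ≤ i → T (ψ i) = 0 := by
  set n := finrank ℂ V with hn
  set n' := finrank ℂ W with hn'
  set m := min n n' with hm
  have hmn : m ≤ n := min_le_left _ _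
  have hmn' : m ≤ n' := min_le_right _ _
  let hT := T.isSymmetric_adjoint_comp_self
  let v := hT.eigenvectorBasis hn.symm
  have hv (i j : Fin n) : inner ℂ (T (v i)) (T (v j)) =
      if i = j then ((T.singularValues i : ℝ) : ℂ) ^ 2 else 0 := by
    rw [← LinearMap.adjoint_inner_right, ← LinearMap.comp_apply,
      hT.apply_eigenvectorBasis hn.symm j, inner_smul_right,
      orthonormal_iff_ite.1 v.orthonormal i j, ← T.sq_singularValues_fin hn.symm j]
    split_ifs with h
    · subst h; simp
    · simp
  -- `singularValues` is decreasing: reversing the first m indices makes it increasing there, while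
  -- the excess indices, whose singular values vanish, stay put.
  have hrev : Function.Involutive fun i : Fin n =>
      if h : (i : ℕ) < m then (⟨m - 1 - i, by omega⟩ : Fin n) else i := by
    intro i
    by_cases h : (i : ℕ) < m
    · have h' : m - 1 - (i : ℕ) < m := by omega
      simp only [h, dite_true, h']
      exact Fin.ext (by simp only; omega)
    · simp only [h, dite_false]
  let π : Equiv.Perm (Fin n) := hrev.toPerm
  let ψ := v.reindex π
  have hψ (i : Fin n) (h : (i : ℕ) < m) : ψ i = v ⟨m - 1 - i, by omega⟩ := by
    simp [ψ, π, OrthonormalBasis.reindex_apply, Function.Involutive.toPerm_symm,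
      Function.Involutive.coe_toPerm, h]
  have hψ0 (i : Fin n) (h : m ≤ (i : ℕ)) : ψ i = v i := by
    simp [ψ, π, OrthonormalBasis.reindex_apply, Function.Involutive.toPerm_symm,
      Function.Involutive.coe_toPerm, h.not_gt]
  let ζ : Fin m → ℝ := fun j => T.singularValues (m - 1 - j)
  have hζ (j : Fin m) : 0 ≤ ζ j := T.singularValues_nonneg _
  have hTψ (i j : Fin m) : inner ℂ (T (ψ (i.castLE hmn))) (T (ψ (j.castLE hmn))) =
      if i = j then (ζ i : ℂ) ^ 2 else 0 := by
    rw [hψ _ (by simp), hψ _ (by simp), hv]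
    have : i = j ↔ m - 1 - (i : ℕ) = m - 1 - (j : ℕ) := by
      rw [Fin.ext_iff]; have := i.2; have := j.2; omega
    simp [Fin.ext_iff, this, ζ]
  -- Normalized images, prescribed only where ζ ≠ 0; the remaining left vectors come from extending
  -- to an orthonormal basis.
  let w : Fin n' → W := fun i =>
    if h : (i : ℕ) < m then ((ζ ⟨i, h⟩ : ℂ)⁻¹) • T (ψ ⟨i, h.trans_le hmn⟩) else 0
  let s : Set (Fin n') := {i | ∃ h : (i : ℕ) < m, ζ ⟨i, h⟩ ≠ 0}
  have hw : Orthonormal ℂ (s.domRestrict w) := by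
    rw [orthonormal_iff_ite]
    rintro ⟨i, hi, hi0⟩ ⟨j, hj, hj0⟩
    have := hTψ ⟨i, hi⟩ ⟨j, hj⟩
    simp only [Fin.castLE_mk] at this
    simp only [Set.domRestrict_apply, w, hi, hj, dite_true, inner_smul_left, inner_smul_right, this]
    by_cases hij : i = j
    · subst hij
      have : (ζ ⟨i, hi⟩ : ℂ) ≠ 0 := by exact_mod_cast hi0
      simp only [if_true, map_inv₀, Complex.conj_ofReal]
      field_simp
    · simp [hij, Fin.ext_iff, Fin.val_inj]
  obtain ⟨ψ', hψ'⟩ := hw.exists_orthonormalBasis_extension_of_card_eq (by simp [hn'])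
  refine ⟨ψ, ψ', ζ, hζ, fun i j hij => T.singularValues_antitone ?_, fun j => ?_, fun i hi => ?_⟩
  · have : (i : ℕ) ≤ j := hij
    omega
  · by_cases h0 : ζ j = 0
    · rw [h0, Complex.ofReal_zero, zero_smul, ← inner_self_eq_zero (𝕜 := ℂ), hTψ, if_pos rfl, h0]
      simp
    · rw [hψ' (j.castLE hmn') ⟨j.2, h0⟩]
      have : (ζ j : ℂ) ≠ 0 := by exact_mod_cast h0
      have hj : ((j.castLE hmn' : Fin n') : ℕ) < m := j.2
      simp only [w, hj, dite_true, smul_smul]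
      rw [show (⟨(j.castLE hmn' : Fin n'), hj⟩ : Fin m) = j from rfl, mul_inv_cancel₀ this, one_smul]
      rfl
  -- The rank is at most m, so singular values from index m on are zero.
  · have hσ : T.singularValues i = 0 := by
      rw [T.singularValues_eq_zero_iff_le_finrank_range]
      exact (le_min (LinearMap.finrank_range_le T) (Submodule.finrank_le _)).trans hi
    rw [hψ0 i hi, ← inner_self_eq_zero (𝕜 := ℂ), hv, if_pos rfl, hσ]
    simp

variable {H : Type*} [NormedAddCommGroup H] [InnerProductSpace ℂ H]

theorem ketbra_apply (x y v : H) : ketbra x y v = inner ℂ y v • x := rfl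

variable [FiniteDimensional ℂ H]

theorem adjoint_ketbra (x y : H) : LinearMap.adjoint (ketbra x y) = ketbra y x := by
  symm
  rw [LinearMap.eq_adjoint_iff]
  intro u v
  rw [ketbra_apply, ketbra_apply, inner_smul_left, inner_smul_right, inner_conj_symm, mul_comm]

theorem apply_mem_range {E : Module.End ℂ H} (hE : IsStarProjection E) (x : LinearMap.range E) :
    E (x : H) = x := by
  obtain ⟨_, y, rfl⟩ := x
  exact LinearMap.congr_fun hE.isIdempotentElem y

/-- E is self-adjoint and fixes each basis vector, so x and E x have the same coefficients. -/
theorem sum_inner_smul_eq {E : Module.End ℂ H} (hE : IsStarProjection E) {ι : Type*} [Fintype ι]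
    (b : OrthonormalBasis ι ℂ (LinearMap.range E)) (x : H) :
    ∑ i, inner ℂ (b i : H) x • (b i : H) = E x := by
  have h := congrArg Subtype.val (b.sum_repr' ⟨E x, LinearMap.mem_range_self E x⟩)
  rw [Submodule.coe_sum] at h
  refine Eq.trans ?_ h
  refine Finset.sum_congr rfl fun i _ => ?_
  have hsa : LinearMap.adjoint E = E := hE.isSelfAdjoint
  rw [Submodule.coe_smul, Submodule.coe_inner]
  change _ = inner ℂ (b i : H) (E x) • _
  rw [← LinearMap.adjoint_inner_left, hsa, apply_mem_range hE]

theorem nonempty_singularValueDecomposition (O : Module.End ℂ H) {E E' : Module.End ℂ H}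
    (hE : IsStarProjection E) : Nonempty (SingularValueDecomposition O E E') := by
  let T : LinearMap.range E →ₗ[ℂ] LinearMap.range E' :=
    (E' * O).restrict (p := LinearMap.range E) (q := LinearMap.range E')
      fun x _ => LinearMap.mem_range_self E' (O x)
  obtain ⟨ψ, ψ', ζ, hζ, hmono, hψ, hψ0⟩ := exists_monotone_svd T
  have hT (x : LinearMap.range E) : (E' * O) x = T x := rfl
  refine ⟨⟨ψ, ψ', ζ, hζ, hmono, ?_⟩⟩
  ext x
  rw [Module.End.mul_apply, ← sum_inner_smul_eq hE ψ, map_sum, LinearMap.sum_apply]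
  symm
  refine Fintype.sum_of_injective (Fin.castLE (min_le_left _ _)) (Fin.castLE_injective _) _ _ ?_ ?_
  · intro i hi
    rw [map_smul, hT, hψ0 i, Submodule.coe_zero, smul_zero]
    by_contra! h
    exact hi ⟨⟨i, h⟩, rfl⟩
  · intro j
    rw [map_smul, hT, hψ, LinearMap.smul_apply, ketbra_apply, Submodule.coe_smul, smul_comm]

/-- The operator is A†A with A = E'OE; the excess vectors are killed by A, in agreement with the
default value 0. -/
theorem SingularValueDecomposition.gram_apply {O E E' : Module.End ℂ H}
    (S : SingularValueDecomposition O E E') (hE : IsStarProjection E) (hE' : IsStarProjection E')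
    (i : Fin (finrank ℂ (LinearMap.range E))) :
    (E * LinearMap.adjoint O * E' * E' * O * E) (S.ψ i) =
      ((S.rightValue i : ℂ) ^ 2) • (S.ψ i : H) := by
  have hsa : LinearMap.adjoint E = E := hE.isSelfAdjoint
  have hsa' : LinearMap.adjoint E' = E' := hE'.isSelfAdjoint
  have hadj : E * LinearMap.adjoint O * E' = LinearMap.adjoint (E' * O * E) := by
    change _ = star (E' * O * E)
    rw [star_mul, star_mul]
    change _ = LinearMap.adjoint E * (LinearMap.adjoint O * LinearMap.adjoint E')
    rw [hsa, hsa', mul_assoc]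
  have hψ (a b) : inner ℂ (S.ψ a : H) (S.ψ b : H) = if a = b then (1 : ℂ) else 0 :=
    orthonormal_iff_ite.1 S.ψ.orthonormal a b
  have hψ' (a b) : inner ℂ (S.ψ' a : H) (S.ψ' b : H) = if a = b then (1 : ℂ) else 0 :=
    orthonormal_iff_ite.1 S.ψ'.orthonormal a b
  have hM : E * LinearMap.adjoint O * E' * E' * O * E =
      LinearMap.adjoint (E' * O * E) * (E' * O * E) := by
    rw [← hadj]; simp only [mul_assoc]
  rw [hM, Module.End.mul_apply, S.decomp, map_sum]
  simp only [map_smulₛₗ, adjoint_ketbra, LinearMap.sum_apply, LinearMap.smul_apply, ketbra_apply,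
    hψ, Complex.conj_ofReal]
  rw [SingularValueDecomposition.rightValue]
  split_ifs with h
  · have h1 (j : Fin (min (finrank ℂ (LinearMap.range E)) (finrank ℂ (LinearMap.range E')))) :
        j.castLE (min_le_left _ _) = i ↔ j = ⟨i, h⟩ := by
      simp [Fin.ext_iff]
    simp only [h1, ite_smul, one_smul, zero_smul, smul_ite, smul_zero, Finset.sum_ite_eq',
      Finset.mem_univ, if_true, inner_smul_right, hψ']
    rw [Fintype.sum_eq_single ⟨i, h⟩]
    · rw [if_pos rfl, mul_one, smul_smul, sq]
      rfl
    · intro j hj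
      rw [if_neg fun h' => hj (Fin.castLE_injective _ h'), mul_zero, zero_smul, smul_zero]
  · have h1 (j : Fin (min (finrank ℂ (LinearMap.range E)) (finrank ℂ (LinearMap.range E')))) :
        j.castLE (min_le_left _ _) ≠ i := by
      rintro rfl; exact h j.2
    simp [h1]

theorem SingularValueDecomposition.aeval_mul_eq_evenTransform {O E E' : Module.End ℂ H}
    (S : SingularValueDecomposition O E E') (hE : IsStarProjection E) (hE' : IsStarProjection E')
    {P Q : ℝ[X]} (hPQ : ∀ x : ℝ, P.eval x = Q.eval (x ^ 2)) :
    aeval (E * LinearMap.adjoint O * E' * E' * O * E) (Q.map (algebraMap ℝ ℂ)) * E =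
      S.evenTransform P := by
  ext x
  rw [Module.End.mul_apply, ← sum_inner_smul_eq hE S.ψ, map_sum,
    SingularValueDecomposition.evenTransform, LinearMap.sum_apply]
  refine Finset.sum_congr rfl fun i _ => ?_
  rw [map_smul, Module.End.aeval_apply_of_mem_apply_eq_smul (S.gram_apply hE hE' i),
    LinearMap.smul_apply, ketbra_apply, smul_comm, hPQ]
  congr 1
  rw [← Complex.ofReal_pow, ← Complex.coe_algebraMap, eval_map_algebraMap,
    aeval_algebraMap_apply, Complex.coe_algebraMap]
  simp

end SingularValues

/-- An even polynomial is a polynomial in the square of the variable. -/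
theorem exists_eval_sq_of_even {P : ℝ[X]} (heven : ∀ x : ℝ, P.eval (-x) = P.eval x) :
    ∃ Q : ℝ[X], 2 * Q.natDegree = P.natDegree ∧ ∀ x : ℝ, P.eval x = Q.eval (x ^ 2) := by
  have hcomp : P.comp (C (-1) * X) = P := Polynomial.funext fun x => by simpa using heven x
  have hodd (n : ℕ) (hn : ¬ 2 ∣ n) : P.coeff n = 0 := by
    have h := congrArg (fun p => coeff p n) hcomp
    simp only [comp_C_mul_X_coeff] at h
    rw [(Nat.not_even_iff_odd.1 fun h => hn h.two_dvd).neg_one_pow] at h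
    linarith
  have hQ : expand ℝ 2 (contract 2 P) = P := by
    ext n
    rw [coeff_expand two_pos]
    split_ifs with h
    · rw [coeff_contract two_ne_zero, Nat.div_mul_cancel h]
    · rw [hodd n h]
  refine ⟨contract 2 P, ?_, fun x => ?_⟩
  · rw [mul_comm, ← natDegree_expand, hQ]
  · rw [← expand_eval, hQ]

end QSVT

/-! ### The main theorem -/

theorem mainTheorem2 (P : Polynomial ℝ) (hdeg : P.natDegree ≠ 0)
    (heven : ∀ x : ℝ, P.eval (-x) = P.eval x)
    (hbound : ∀ x ∈ Set.Icc (-1 : ℝ) 1, |P.eval x| ≤ 1) :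
    ∃ Pt : Polynomial ℝ, 2 * Pt.natDegree = P.natDegree ∧
      (∀ x : ℝ, P.eval x = Pt.eval (x ^ 2)) ∧
      ∃ Φ : Fin P.natDegree → ℝ,
        ∀ (H : Type*) [NormedAddCommGroup H] [InnerProductSpace ℂ H] [FiniteDimensional ℂ H]
          (O E E' : Module.End ℂ H),
          O ∈ unitary (Module.End ℂ H) → IsStarProjection E → IsStarProjection E' →
          -- both sides are operators on the range of `E`, extended by zero, hence the factor `E`
          QSVT.circuitBlock O E E' Φ =
              Polynomial.aeval (E * LinearMap.adjoint O * E' * E' * O * E)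
                (Pt.map (algebraMap ℝ ℂ)) * E ∧
            Nonempty (QSVT.SingularValueDecomposition O E E') ∧
            ∀ S : QSVT.SingularValueDecomposition O E E',
              QSVT.circuitBlock O E E' Φ = S.evenTransform P := by
  obtain ⟨Pt, hd, hPt⟩ := QSVT.exists_eval_sq_of_even heven
  have hb : ∀ y ∈ Set.Icc (0 : ℝ) 1, |Pt.eval y| ≤ 1 := fun y hy => by
    have h := hbound (√y) ⟨by linarith [Real.sqrt_nonneg y], Real.sqrt_le_one.2 hy.2⟩
    rwa [hPt, Real.sq_sqrt hy.1] at h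
  obtain ⟨φ, hφ⟩ := QSVT.exists_phases_of_abs_le_one (by omega) hb
  rw [hd] at hφ
  -- The phases are fixed before the space and the operators enter; only the first d terms of the
  -- sequence are kept.
  refine ⟨Pt, hd, hPt, fun j => φ j, ?_⟩
  intro H _ _ _ O E E' hO hE hE'
  have hblock := QSVT.circuitBlock_eq_aeval hO hE.isIdempotentElem hE'.isIdempotentElem
    (hd ▸ even_two_mul _) hφ
  exact ⟨hblock, QSVT.nonempty_singularValueDecomposition O hE,
    fun S => hblock.trans (S.aeval_mul_eq_evenTransform hE hE' hPt)⟩
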